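/- Let $(M,\omega)$ be a connected symplectic manifold (smooth, finite-dimensional, Hausdorff, without boundary; $\omega$ is a closed nondegenerate smooth $2$-form). Let $\mathfrak X(M)$ be the Lie algebra of smooth vector fields on $M$ and let $$\mathfrak X(M,[\omega]) := \{X\in\mathfrak X(M) : \text{there is } \lambda\in\mathbb R \text{ with } L_X\omega=\lambda\omega\}$$ be the Lie subalgebra of conformally symplectic vector fields. Then there is no Lie subalgebra $\mathfrak g$ of $\mathfrak X(M)$ with $\mathfrak X(M,[\omega])\subsetneq\mathfrak g\subseteq\mathfrak X(M)$ such that $\mathfrak X(M,[\omega])$ has finite codimension in $\mathfrak g$, that is, such that the real vector space $\mathfrak g/\mathfrak X(M,[\omega])$ is finite-dimensional. -/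

import Mathlib

open scoped Manifold ContDiff Bundle
open VectorField

namespace SymplecticManifold

section Defs

variable (E : Type*) [NormedAddCommGroup E] [NormedSpace ℝ E]
  (M : Type*) [TopologicalSpace M] [ChartedSpace E M] [IsManifold 𝓘(ℝ, E) ∞ M]

/-- The real vector space `𝔛(M)` of smooth vector fields on the smooth manifold `M` (without
boundary, modelled on `E`), i.e. of smooth sections of the tangent bundle. -/
abbrev SmoothVectorField : Type _ :=
  ContMDiffSection 𝓘(ℝ, E) E ∞ (fun x : M => TangentSpace 𝓘(ℝ, E) x)

/-- A smooth differential `2`-form on `M`: a smooth section of the bundle of bilinear forms on the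
tangent spaces, alternating at each point. -/
structure TwoForm where
  /-- the bilinear form at the point `x` -/
  toFun (x : M) : TangentSpace 𝓘(ℝ, E) x →L[ℝ] TangentSpace 𝓘(ℝ, E) x →L[ℝ] ℝ
  alternating (x : M) (v : TangentSpace 𝓘(ℝ, E) x) : toFun x v v = 0
  smooth : ContMDiff 𝓘(ℝ, E) (𝓘(ℝ, E).prod 𝓘(ℝ, E →L[ℝ] E →L[ℝ] ℝ)) ∞
    (fun x => Bundle.TotalSpace.mk' (E →L[ℝ] E →L[ℝ] ℝ)
      (E := fun x : M =>
        (TangentSpace 𝓘(ℝ, E) x →L[ℝ] TangentSpace 𝓘(ℝ, E) x →L[ℝ] ℝ)) x (toFun x))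

variable {E M}

/-- The derivative `X f` of the function `f` along the vector field `X`. -/
noncomputable def dirDeriv (X : SmoothVectorField E M) (f : M → ℝ) (x : M) : ℝ :=
  mvfderiv 𝓘(ℝ, E) f x (X x)

/-- The function `α(Y, Z)`. -/
noncomputable def TwoForm.eval (α : TwoForm E M) (Y Z : SmoothVectorField E M) (x : M) : ℝ :=
  α.toFun x (Y x) (Z x)

end Defs

section Bracket

variable {E : Type*} [NormedAddCommGroup E] [NormedSpace ℝ E]
  {M : Type*} [TopologicalSpace M] [ChartedSpace E M] [IsManifold 𝓘(ℝ, E) ∞ M]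

theorem SmoothVectorField.mdifferentiableAt (X : SmoothVectorField E M) (x : M) :
    MDifferentiableAt 𝓘(ℝ, E) (𝓘(ℝ, E).prod 𝓘(ℝ, E))
      (fun y => (Bundle.TotalSpace.mk' E y (X y) : TangentBundle 𝓘(ℝ, E) M)) x :=
  (X.contMDiff x).mdifferentiableAt (by simp)

theorem isManifold_two : IsManifold 𝓘(ℝ, E) (minSmoothness ℝ 2) M := by
  simp only [minSmoothness_of_isRCLikeNormedField]
  infer_instance

theorem isManifold_three : IsManifold 𝓘(ℝ, E) (minSmoothness ℝ 3) M := by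
  simp only [minSmoothness_of_isRCLikeNormedField]
  infer_instance

theorem contMDiff_dirDeriv (X : SmoothVectorField E M) {f : M → ℝ}
    (hf : ContMDiff 𝓘(ℝ, E) 𝓘(ℝ, ℝ) ∞ f) :
    ContMDiff 𝓘(ℝ, E) 𝓘(ℝ, ℝ) ∞ (dirDeriv X f) := by
  have h1 : ContMDiff 𝓘(ℝ, E).tangent 𝓘(ℝ, ℝ).tangent ∞ (tangentMap 𝓘(ℝ, E) 𝓘(ℝ, ℝ) f) :=
    hf.contMDiff_tangentMap (by simp)
  exact (contMDiff_snd_tangentBundle_modelSpace ℝ 𝓘(ℝ, ℝ)).comp (h1.comp X.contMDiff)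

theorem TwoForm.contMDiff_eval (α : TwoForm E M) (Y Z : SmoothVectorField E M) :
    ContMDiff 𝓘(ℝ, E) 𝓘(ℝ, ℝ) ∞ (α.eval Y Z) := by
  have h := ContMDiff.clm_bundle_apply₂ (E₁ := fun x : M => TangentSpace 𝓘(ℝ, E) x)
    (E₂ := fun x : M => TangentSpace 𝓘(ℝ, E) x) (E₃ := Bundle.Trivial M ℝ) (F₁ := E) (F₂ := E)
    (F₃ := ℝ) (b := id) (ψ := α.toFun) (v := Y) (w := Z) α.smooth Y.contMDiff Z.contMDiff
  intro x
  have := h x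
  simp only [Bundle.contMDiffAt_totalSpace] at this
  simpa using! this.2

variable [FiniteDimensional ℝ E]

/-- The Lie bracket of vector fields. -/
noncomputable instance : Bracket (SmoothVectorField E M) (SmoothVectorField E M) where
  bracket X Y :=
    { toFun := mlieBracket 𝓘(ℝ, E) X Y
      contMDiff_toFun := by
        have : CompleteSpace E := FiniteDimensional.complete ℝ E
        have := isManifold_two (E := E) (M := M)
        have : IsManifold 𝓘(ℝ, E) ((⊤ : ℕ∞) + 1) M := by simpa using! ‹IsManifold 𝓘(ℝ, E) ∞ M›
        exact fun x => ContMDiffAt.mlieBracket_vectorField (m := ⊤) (n := ⊤)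
          (X.contMDiff x) (Y.contMDiff x) (by simp) }

theorem bracket_apply (X Y : SmoothVectorField E M) (x : M) :
    ⁅X, Y⁆ x = mlieBracket 𝓘(ℝ, E) X Y x := rfl

noncomputable instance : LieRing (SmoothVectorField E M) where
  add_lie X Y Z := by
    have : CompleteSpace E := FiniteDimensional.complete ℝ E
    have := isManifold_two (E := E) (M := M)
    ext x
    exact mlieBracket_add_left (X.mdifferentiableAt x) (Y.mdifferentiableAt x)
  lie_add X Y Z := by
    have : CompleteSpace E := FiniteDimensional.complete ℝ E
    have := isManifold_two (E := E) (M := M)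
    ext x
    exact mlieBracket_add_right (Y.mdifferentiableAt x) (Z.mdifferentiableAt x)
  lie_self X := by
    ext x
    simp [bracket_apply]
  leibniz_lie X Y Z := by
    have : CompleteSpace E := FiniteDimensional.complete ℝ E
    have := isManifold_three (E := E) (M := M)
    ext x
    have h2 : minSmoothness ℝ 2 ≤ ∞ := by simpa using! ENat.LEInfty.out (m := 2)
    exact leibniz_identity_mlieBracket_apply ((X.contMDiff x).of_le h2)
      ((Y.contMDiff x).of_le h2) ((Z.contMDiff x).of_le h2)

noncomputable instance : LieAlgebra ℝ (SmoothVectorField E M) where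
  lie_smul c X Y := by
    have : CompleteSpace E := FiniteDimensional.complete ℝ E
    have := isManifold_two (E := E) (M := M)
    ext x
    exact mlieBracket_const_smul_right (Y.mdifferentiableAt x)

theorem dirDeriv_bracket (X Y : SmoothVectorField E M) {f : M → ℝ}
    (hf : ContMDiff 𝓘(ℝ, E) 𝓘(ℝ, ℝ) ∞ f) (x : M) :
    dirDeriv ⁅X, Y⁆ f x = dirDeriv X (dirDeriv Y f) x - dirDeriv Y (dirDeriv X f) x := by
  have : CompleteSpace E := FiniteDimensional.complete ℝ E
  have := isManifold_two (E := E) (M := M)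
  have := isManifold_three (E := E) (M := M)
  have hfd (y : M) : MDifferentiableAt 𝓘(ℝ, E) 𝓘(ℝ, ℝ) f y := (hf y).mdifferentiableAt (by simp)
  have hXf (y : M) : MDifferentiableAt 𝓘(ℝ, E) 𝓘(ℝ, ℝ) (dirDeriv X f) y :=
    (contMDiff_dirDeriv X hf y).mdifferentiableAt (by simp)
  have hYf (y : M) : MDifferentiableAt 𝓘(ℝ, E) 𝓘(ℝ, ℝ) (dirDeriv Y f) y :=
    (contMDiff_dirDeriv Y hf y).mdifferentiableAt (by simp)
  -- Compare coefficients of `W` in the Jacobi identity for `X`, `Y`, `f W`.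
  by_cases hE : Subsingleton (TangentSpace 𝓘(ℝ, E) x)
  · have hz (U : SmoothVectorField E M) (g : M → ℝ) : dirDeriv U g x = 0 := by
      rw [dirDeriv, Subsingleton.elim (U x) 0, map_zero]
    simp [hz]
  rw [not_subsingleton_iff_nontrivial] at hE
  obtain ⟨w, hw⟩ := exists_ne (0 : TangentSpace 𝓘(ℝ, E) x)
  let W : (y : M) → TangentSpace 𝓘(ℝ, E) y := FiberBundle.extend E w
  have hWx : W x = w := by simp [W]
  have hW : ContMDiffAt 𝓘(ℝ, E) (𝓘(ℝ, E).prod 𝓘(ℝ, E)) ∞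
      (fun y => (Bundle.TotalSpace.mk' E y (W y) : TangentBundle 𝓘(ℝ, E) M)) x :=
    FiberBundle.contMDiffAt_extend 𝓘(ℝ, E) E w
  have hWd := hW.mdifferentiableAt (by simp)
  have hWev : ∀ᶠ y in nhds x, MDifferentiableAt 𝓘(ℝ, E) (𝓘(ℝ, E).prod 𝓘(ℝ, E))
      (fun y => (Bundle.TotalSpace.mk' E y (W y) : TangentBundle 𝓘(ℝ, E) M)) y := by
    obtain ⟨t, ht, htW⟩ := FiberBundle.exists_mdifferentiableOn_extend 𝓘(ℝ, E) E w
    filter_upwards [eventually_mem_nhds_iff.2 ht] with y hy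
    exact (htW y (mem_of_mem_nhds hy)).mdifferentiableAt hy
  have : IsManifold 𝓘(ℝ, E) ((⊤ : ℕ∞) + 1) M := by simpa using! ‹IsManifold 𝓘(ℝ, E) ∞ M›
  have hB (U : SmoothVectorField E M) : MDifferentiableAt 𝓘(ℝ, E) (𝓘(ℝ, E).prod 𝓘(ℝ, E))
      (fun y => (Bundle.TotalSpace.mk' E y (mlieBracket 𝓘(ℝ, E) U W y) :
        TangentBundle 𝓘(ℝ, E) M)) x :=
    (ContMDiffAt.mlieBracket_vectorField (m := ⊤) (n := ⊤)
          (U.contMDiff x) hW (by simp)).mdifferentiableAt (by simp)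
  have hfW : ContMDiffAt 𝓘(ℝ, E) (𝓘(ℝ, E).prod 𝓘(ℝ, E)) ∞
      (fun y => (Bundle.TotalSpace.mk' E y ((f • W) y) : TangentBundle 𝓘(ℝ, E) M)) x :=
    (hf x).smul_section hW
  have hb (U : SmoothVectorField E M) :
      mlieBracket 𝓘(ℝ, E) U (f • W) =ᶠ[nhds x]
        dirDeriv U f • W + f • mlieBracket 𝓘(ℝ, E) U W := by
    filter_upwards [hWev] with y hy
    exact mlieBracket_smul_right (hfd y) hy
  have hbb (U V : SmoothVectorField E M) :
      mlieBracket 𝓘(ℝ, E) U (mlieBracket 𝓘(ℝ, E) V (f • W)) x =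
        (dirDeriv U (dirDeriv V f) x • W x + dirDeriv V f x • mlieBracket 𝓘(ℝ, E) U W x) +
        (dirDeriv U f x • mlieBracket 𝓘(ℝ, E) V W x +
          f x • mlieBracket 𝓘(ℝ, E) U (mlieBracket 𝓘(ℝ, E) V W) x) := by
    have hVf : MDifferentiableAt 𝓘(ℝ, E) 𝓘(ℝ, ℝ) (dirDeriv V f) x :=
      (contMDiff_dirDeriv V hf x).mdifferentiableAt (by simp)
    refine (Filter.EventuallyEq.mlieBracket_vectorField_eq
      (Filter.EventuallyEq.refl _ _) (hb V)).trans ?_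
    rw [mlieBracket_add_right (hVf.smul_section hWd) ((hfd x).smul_section (hB V)),
      mlieBracket_smul_right hVf hWd, mlieBracket_smul_right (hfd x) (hB V)]
    rfl
  have h2 : minSmoothness ℝ 2 ≤ ∞ := by simpa using! ENat.LEInfty.out (m := 2)
  have hX2 := (X.contMDiff x).of_le h2
  have hY2 := (Y.contMDiff x).of_le h2
  have j1 := leibniz_identity_mlieBracket_apply hX2 hY2 (hfW.of_le h2)
  have j2 := leibniz_identity_mlieBracket_apply hX2 hY2 (hW.of_le h2)
  have j3 : mlieBracket 𝓘(ℝ, E) (mlieBracket 𝓘(ℝ, E) X Y) (f • W) x =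
      dirDeriv ⁅X, Y⁆ f x • W x +
        f x • mlieBracket 𝓘(ℝ, E) (mlieBracket 𝓘(ℝ, E) X Y) W x :=
    mlieBracket_smul_right (hfd x) hWd
  rw [hbb, hbb, j3, j2, hWx] at j1
  have j4 : (dirDeriv ⁅X, Y⁆ f x -
      (dirDeriv X (dirDeriv Y f) x - dirDeriv Y (dirDeriv X f) x)) • w = 0 := by
    rw [← sub_eq_zero] at j1
    rw [← neg_eq_zero, ← j1]
    module
  exact sub_eq_zero.1 ((smul_eq_zero.1 j4).resolve_right hw)

/-- The exterior derivative `dα`, evaluated on three vector fields. -/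
noncomputable def TwoForm.extDeriv (α : TwoForm E M) (X Y Z : SmoothVectorField E M) (x : M) : ℝ :=
  dirDeriv X (α.eval Y Z) x - dirDeriv Y (α.eval X Z) x + dirDeriv Z (α.eval X Y) x
    - α.eval ⁅X, Y⁆ Z x + α.eval ⁅X, Z⁆ Y x - α.eval ⁅Y, Z⁆ X x

/-- The Lie derivative `L_X α`, evaluated on two vector fields `Y`, `Z`. -/
noncomputable def TwoForm.lieDeriv (X : SmoothVectorField E M) (α : TwoForm E M)
    (Y Z : SmoothVectorField E M) (x : M) : ℝ :=
  dirDeriv X (α.eval Y Z) x - α.eval ⁅X, Y⁆ Z x - α.eval Y ⁅X, Z⁆ x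

end Bracket

section Symplectic

variable (E : Type*) [NormedAddCommGroup E] [NormedSpace ℝ E] [FiniteDimensional ℝ E]
  (M : Type*) [TopologicalSpace M] [ChartedSpace E M] [IsManifold 𝓘(ℝ, E) ∞ M]

/-- A symplectic form on `M`: a closed nondegenerate smooth `2`-form. -/
structure SymplecticForm extends TwoForm E M where
  nondegenerate (x : M) (v : TangentSpace 𝓘(ℝ, E) x) : (∀ w, toFun x v w = 0) → v = 0
  closed (X Y Z : SmoothVectorField E M) (x : M) : toTwoForm.extDeriv X Y Z x = 0

variable {E M}

/-- The Lie algebra `𝔛(M, [Ω])` of conformally symplectic vector fields: those `X` for which there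
is a real constant `c` with `L_X Ω = c Ω`. -/
noncomputable def conformallySymplectic (Ω : SymplecticForm E M) :
    LieSubalgebra ℝ (SmoothVectorField E M) where
  carrier := {X | ∃ c : ℝ, ∀ (Y Z : SmoothVectorField E M) (x : M),
    Ω.lieDeriv X Y Z x = c * Ω.eval Y Z x}
  zero_mem' := by
    refine ⟨0, fun Y Z x => ?_⟩
    simp [TwoForm.lieDeriv, dirDeriv, TwoForm.eval]
  add_mem' := by
    rintro X X' ⟨c, hc⟩ ⟨c', hc'⟩
    refine ⟨c + c', fun Y Z x => ?_⟩
    have h := hc Y Z x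
    have h' := hc' Y Z x
    simp only [TwoForm.lieDeriv, dirDeriv, TwoForm.eval, add_lie, ContMDiffSection.coe_add,
      Pi.add_apply, map_add, add_apply] at h h' ⊢
    linarith
  smul_mem' := by
    rintro a X ⟨c, hc⟩
    refine ⟨a * c, fun Y Z x => ?_⟩
    have h := hc Y Z x
    simp only [TwoForm.lieDeriv, dirDeriv, TwoForm.eval, smul_lie, ContMDiffSection.coe_smul,
      Pi.smul_apply, map_smul, smul_apply, smul_eq_mul] at h ⊢
    linear_combination a * h
  lie_mem' := by
    rintro X X' ⟨c, hc⟩ ⟨c', hc'⟩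
    refine ⟨0, fun Y Z x => ?_⟩
    have hd (U V : SmoothVectorField E M) (y : M) :
        MDifferentiableAt 𝓘(ℝ, E) 𝓘(ℝ, ℝ) (Ω.eval U V) y :=
      (Ω.contMDiff_eval U V y).mdifferentiableAt (by simp)
    have key (T : SmoothVectorField E M) (a : ℝ) (h : ∀ (Y Z : SmoothVectorField E M) (x : M),
        Ω.lieDeriv T Y Z x = a * Ω.eval Y Z x) (Y Z : SmoothVectorField E M) :
        dirDeriv T (Ω.eval Y Z) =
          (fun _ => a) * Ω.eval Y Z + Ω.eval ⁅T, Y⁆ Z + Ω.eval Y ⁅T, Z⁆ := by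
      funext y
      have := h Y Z y
      simp only [TwoForm.lieDeriv] at this
      simp only [Pi.add_apply, Pi.mul_apply]
      linarith
    have key2 (S T : SmoothVectorField E M) (a b : ℝ)
        (hS : ∀ (Y Z : SmoothVectorField E M) (x : M), Ω.lieDeriv S Y Z x = a * Ω.eval Y Z x)
        (hT : ∀ (Y Z : SmoothVectorField E M) (x : M), Ω.lieDeriv T Y Z x = b * Ω.eval Y Z x) :
        dirDeriv S (dirDeriv T (Ω.eval Y Z)) x =
          b * dirDeriv S (Ω.eval Y Z) x + dirDeriv S (Ω.eval ⁅T, Y⁆ Z) x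
            + dirDeriv S (Ω.eval Y ⁅T, Z⁆) x := by
      rw [key T b hT]
      simp only [dirDeriv]
      rw [mvfderiv_add (((mdifferentiableAt_const).mul (hd _ _ _)).add (hd _ _ _)) (hd _ _ _),
        mvfderiv_add ((mdifferentiableAt_const).mul (hd _ _ _)) (hd _ _ _),
        mvfderiv_mul mdifferentiableAt_const (hd _ _ _)]
      simp [mvfderiv_const]
    have e1 := key2 X X' c c' hc hc'
    have e2 := key2 X' X c' c hc' hc
    have e3 := dirDeriv_bracket X X' (Ω.contMDiff_eval Y Z) x
    rw [e1, e2, key X c hc, key X c hc, key X c hc, key X' c' hc', key X' c' hc',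
      key X' c' hc'] at e3
    simp only [TwoForm.lieDeriv, e3, lie_lie, Pi.add_apply, Pi.mul_apply]
    simp only [TwoForm.eval, ContMDiffSection.coe_sub, Pi.sub_apply, map_sub,
      sub_apply]
    ring

end Symplectic

end SymplecticManifold

/-! Let `V ∈ 𝔤`, let `X` be the Hamiltonian field of a smooth `f`, and put `β = L_V Ω`. Since `X` is
conformally symplectic, `[X, V] ∈ 𝔤`. The operator `f ↦ L_[X,V] Ω` is local, and modulo `ℝ Ω` it has
finite rank because the codimension is finite. A nonzero local operator has infinite rank: cutting
`f` off around many points of the open set where the value is nonzero gives independent values.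
Hence `L_[X,V] Ω = 0` for all `f` (`lieDeriv_bracket_eq_zero`).

As `L_X Ω = 0`, this says `L_X β = 0` for every Hamiltonian `X`. The field of `f²` is `2fX`, and
`L_{fX} β = f L_X β + df ∧ i_X β`, so `i_X Ω ∧ i_X β = 0`. Every tangent vector is the value of a
Hamiltonian field, so `i_u Ω ∧ i_u β = 0` for all `u` (`lieDeriv_proportional`), and linear algebra
yields `β = c Ω` pointwise (`eq_mul_of_proportional`). Then `0 = L_X (c Ω) = (X c) Ω` gives `dc =
0`, and connectedness makes `c` constant, so `V` is conformally symplectic. -/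

namespace SymplecticManifold

/-! ### Functions and vector fields on a manifold. -/

section Charted

variable {E : Type*} [NormedAddCommGroup E] [NormedSpace ℝ E]
  {M : Type*} [TopologicalSpace M] [ChartedSpace E M]

theorem mdifferentiableAt_of_contMDiff {f : M → ℝ} (hf : ContMDiff 𝓘(ℝ, E) 𝓘(ℝ, ℝ) ∞ f)
    (x : M) : MDifferentiableAt 𝓘(ℝ, E) 𝓘(ℝ, ℝ) f x :=
  (hf x).mdifferentiableAt (by simp)

/-- Supplies as many points as the rank argument needs. In dimension zero the claim fails, since
points are open. -/
theorem infinite_of_isOpen [Nontrivial E] {U : Set M} (hU : IsOpen U) (hne : U.Nonempty) :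
    U.Infinite := by
  obtain ⟨x, hx⟩ := hne
  have h := (chartAt E x).image_mem_nhds (mem_chart_source E x) (hU.mem_nhds hx)
  have : (nhdsWithin (chartAt E x x) {chartAt E x x}ᶜ).NeBot := Module.punctured_nhds_neBot ℝ E _
  exact (infinite_of_mem_nhds _ h).of_image _

end Charted

section Fields

variable {E : Type*} [NormedAddCommGroup E] [NormedSpace ℝ E]
  {M : Type*} [TopologicalSpace M] [ChartedSpace E M] [IsManifold 𝓘(ℝ, E) ∞ M]

/-- The product of a smooth function and a smooth vector field. -/
noncomputable def SmoothVectorField.fsmul (f : M → ℝ) (hf : ContMDiff 𝓘(ℝ, E) 𝓘(ℝ, ℝ) ∞ f)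
    (X : SmoothVectorField E M) : SmoothVectorField E M :=
  ⟨f • ⇑X, hf.smul_section X.contMDiff⟩

theorem SmoothVectorField.fsmul_apply (f : M → ℝ) (hf : ContMDiff 𝓘(ℝ, E) 𝓘(ℝ, ℝ) ∞ f)
    (X : SmoothVectorField E M) (x : M) : X.fsmul f hf x = f x • X x := rfl

theorem dirDeriv_congr {X X' : SmoothVectorField E M} {f f' : M → ℝ} {x : M}
    (hX : X x = X' x) (hf : f =ᶠ[nhds x] f') : dirDeriv X f x = dirDeriv X' f' x := by
  have h1 := hf.mfderiv_eq (I := 𝓘(ℝ, E)) (I' := 𝓘(ℝ, ℝ))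
  simp only [dirDeriv, mvfderiv, ContinuousLinearMap.comp_apply, hX]
  rw [h1]
  rfl

theorem dirDeriv_mul (X : SmoothVectorField E M) {f g : M → ℝ}
    (hf : ContMDiff 𝓘(ℝ, E) 𝓘(ℝ, ℝ) ∞ f) (hg : ContMDiff 𝓘(ℝ, E) 𝓘(ℝ, ℝ) ∞ g) (x : M) :
    dirDeriv X (f * g) x = f x * dirDeriv X g x + g x * dirDeriv X f x := by
  simp [dirDeriv, mvfderiv_mul (mdifferentiableAt_of_contMDiff hf x)
    (mdifferentiableAt_of_contMDiff hg x)]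

theorem dirDeriv_add (X : SmoothVectorField E M) {f g : M → ℝ}
    (hf : ContMDiff 𝓘(ℝ, E) 𝓘(ℝ, ℝ) ∞ f) (hg : ContMDiff 𝓘(ℝ, E) 𝓘(ℝ, ℝ) ∞ g) (x : M) :
    dirDeriv X (f + g) x = dirDeriv X f x + dirDeriv X g x := by
  simp [dirDeriv, mvfderiv_add (mdifferentiableAt_of_contMDiff hf x)
    (mdifferentiableAt_of_contMDiff hg x)]

theorem dirDeriv_sub (X : SmoothVectorField E M) {f g : M → ℝ}
    (hf : ContMDiff 𝓘(ℝ, E) 𝓘(ℝ, ℝ) ∞ f) (hg : ContMDiff 𝓘(ℝ, E) 𝓘(ℝ, ℝ) ∞ g) (x : M) :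
    dirDeriv X (f - g) x = dirDeriv X f x - dirDeriv X g x := by
  simp [dirDeriv, mvfderiv_sub (mdifferentiableAt_of_contMDiff hf x)
    (mdifferentiableAt_of_contMDiff hg x)]

variable [FiniteDimensional ℝ E]

theorem bracket_congr {X X' Y Y' : SmoothVectorField E M} {x : M}
    (hX : ⇑X =ᶠ[nhds x] ⇑X') (hY : ⇑Y =ᶠ[nhds x] ⇑Y') :
    (⇑⁅X, Y⁆ : (y : M) → TangentSpace 𝓘(ℝ, E) y) =ᶠ[nhds x] ⇑⁅X', Y'⁆ :=
  hX.mlieBracket_vectorField hY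

theorem bracket_fsmul_left_apply {f : M → ℝ} (hf : ContMDiff 𝓘(ℝ, E) 𝓘(ℝ, ℝ) ∞ f)
    (X Y : SmoothVectorField E M) (x : M) :
    ⁅X.fsmul f hf, Y⁆ x = -dirDeriv Y f x • X x + f x • ⁅X, Y⁆ x := by
  have : CompleteSpace E := FiniteDimensional.complete ℝ E
  have := isManifold_two (E := E) (M := M)
  exact mlieBracket_smul_left (mdifferentiableAt_of_contMDiff hf x) (X.mdifferentiableAt x)

variable [T2Space M]

/-- A local extension of `v` is multiplied by a bump function supported where that extension is
smooth. -/
theorem exists_field (x : M) (v : TangentSpace 𝓘(ℝ, E) x) :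
    ∃ X : SmoothVectorField E M, X x = v := by
  obtain ⟨s, hs, hW⟩ := FiberBundle.exists_contMDiffOn_extend (k := ∞) 𝓘(ℝ, E) E v
  obtain ⟨t, hts, ht, hxt⟩ := mem_nhds_iff.1 hs
  obtain ⟨χ, -, hχ⟩ := (SmoothBumpFunction.nhds_basis_tsupport (I := 𝓘(ℝ, E)) x).mem_iff.1
    (ht.mem_nhds hxt)
  refine ⟨⟨(χ : M → ℝ) • FiberBundle.extend E v, ContMDiffOn.smul_section_of_tsupport
    (χ.contMDiff.contMDiffOn) ht hχ (hW.mono hts)⟩, ?_⟩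
  change χ x • FiberBundle.extend E v x = v
  simp

/-- The function is `l` in the chart at `x`, cut off by a bump function. That chart has identity
derivative at `x`, in the trivialization that identifies the tangent space with `E`. -/
theorem exists_dirDeriv_eq (x : M) (l : TangentSpace 𝓘(ℝ, E) x →L[ℝ] ℝ) :
    ∃ f : M → ℝ, ContMDiff 𝓘(ℝ, E) 𝓘(ℝ, ℝ) ∞ f ∧
      ∀ X : SmoothVectorField E M, dirDeriv X f x = l (X x) := by
  obtain ⟨χ, -, -⟩ := (SmoothBumpFunction.nhds_basis_tsupport (I := 𝓘(ℝ, E)) x).mem_iff.1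
    Filter.univ_mem
  let l' : E →L[ℝ] ℝ := l
  let g : M → ℝ := fun y => l' (extChartAt 𝓘(ℝ, E) x y)
  have hg : ContMDiffOn 𝓘(ℝ, E) 𝓘(ℝ, ℝ) ∞ g (chartAt E x).source :=
    l'.contMDiff.comp_contMDiffOn (contMDiffOn_extChartAt (I := 𝓘(ℝ, E)) (x := x) (n := ∞))
  refine ⟨fun y => χ y • g y, χ.contMDiff_smul hg, fun X => ?_⟩
  have h1 : (fun y => χ y • g y) =ᶠ[nhds x] g := by
    filter_upwards [χ.eventuallyEq_one] with y hy
    simp [hy]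
  rw [dirDeriv_congr rfl h1]
  have h2 : HasMFDerivAt 𝓘(ℝ, E) 𝓘(ℝ, ℝ) g x
      (ContinuousLinearMap.comp (l' : E →L[ℝ] ℝ) (ContinuousLinearMap.id ℝ E)) := by
    have h3 := (mdifferentiableAt_extChartAt (I := 𝓘(ℝ, E))
      (mem_chart_source E x)).hasMFDerivAt
    rw [mfderiv_extChartAt_self] at h3
    exact HasMFDerivAt.comp x l'.hasMFDerivAt h3
  simp only [dirDeriv, mvfderiv, h2.mfderiv]
  rfl

end Fields

section Constancy

variable {E : Type*} [NormedAddCommGroup E] [NormedSpace ℝ E]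
  {M : Type*} [TopologicalSpace M] [ChartedSpace E M] [IsManifold 𝓘(ℝ, E) ∞ M]

/-- Read in a chart, the derivative vanishes on a ball, which is convex. -/
theorem isLocallyConstant_of_mvfderiv_eq_zero {c : M → ℝ}
    (hc : ContMDiff 𝓘(ℝ, E) 𝓘(ℝ, ℝ) ∞ c)
    (h0 : ∀ x, mvfderiv 𝓘(ℝ, E) c x = 0) : IsLocallyConstant c := by
  have h0' (x : M) : HasMFDerivAt 𝓘(ℝ, E) 𝓘(ℝ, ℝ) c x (0 : E →L[ℝ] ℝ) := by
    have := (mdifferentiableAt_of_contMDiff hc x).hasMFDerivAt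
    have h := h0 x
    have e : mfderiv 𝓘(ℝ, E) 𝓘(ℝ, ℝ) c x = (0 : E →L[ℝ] ℝ) := h
    rwa [e] at this
  rw [IsLocallyConstant.iff_eventually_eq]
  intro x
  let φ := extChartAt 𝓘(ℝ, E) x
  have hopen : IsOpen φ.target := isOpen_extChartAt_target x
  have hd : ∀ z ∈ φ.target, HasFDerivAt (c ∘ φ.symm) (0 : E →L[ℝ] ℝ) z := by
    intro z hz
    have h1 : MDifferentiableAt 𝓘(ℝ, E) 𝓘(ℝ, E) φ.symm z :=
      ((contMDiffOn_extChartAt_symm (I := 𝓘(ℝ, E)) (n := ∞) x).contMDiffAt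
        (hopen.mem_nhds hz)).mdifferentiableAt (by simp)
    have h2 := HasMFDerivAt.comp z (h0' (φ.symm z)) h1.hasMFDerivAt
    have h3 := hasMFDerivAt_iff_hasFDerivAt.1 h2
    exact h3
  have hx : φ x ∈ φ.target := mem_extChartAt_target x
  obtain ⟨r, hr, hball⟩ := Metric.isOpen_iff.1 hopen _ hx
  filter_upwards [(continuousAt_extChartAt (I := 𝓘(ℝ, E)) x).preimage_mem_nhds
    (Metric.ball_mem_nhds _ hr), extChartAt_source_mem_nhds (I := 𝓘(ℝ, E)) x] with y hy hys
  have hcst := (convex_ball (φ x) r).is_const_of_fderivWithin_eq_zero (𝕜 := ℝ) (f := c ∘ φ.symm)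
    (fun z hz => (hd z (hball hz)).differentiableAt.differentiableWithinAt)
    (fun z hz => by
      rw [fderivWithin_of_isOpen Metric.isOpen_ball hz, (hd z (hball hz)).fderiv])
    hy (Metric.mem_ball_self hr)
  simp only [Function.comp_apply] at hcst
  rwa [φ.left_inv hys, φ.left_inv (mem_extChartAt_source x)] at hcst

end Constancy

/-! ### Smooth dependence of determinants and adjugates, for Cramer's rule. -/

section Matrices

variable {E : Type*} [NormedAddCommGroup E] [NormedSpace ℝ E]
  {M : Type*} [TopologicalSpace M] [ChartedSpace E M] {ι : Type*} [Fintype ι] [DecidableEq ι]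

theorem contMDiff_det {A : M → Matrix ι ι ℝ}
    (hA : ∀ i j, ContMDiff 𝓘(ℝ, E) 𝓘(ℝ, ℝ) ∞ fun y => A y i j) :
    ContMDiff 𝓘(ℝ, E) 𝓘(ℝ, ℝ) ∞ fun y => (A y).det := by
  simp only [Matrix.det_apply']
  exact contMDiff_finsetSum fun σ _ =>
    contMDiff_const.mul (contMDiff_finsetProd fun i _ => hA _ _)

theorem contMDiff_adjugate {A : M → Matrix ι ι ℝ}
    (hA : ∀ i j, ContMDiff 𝓘(ℝ, E) 𝓘(ℝ, ℝ) ∞ fun y => A y i j) (i j : ι) :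
    ContMDiff 𝓘(ℝ, E) 𝓘(ℝ, ℝ) ∞ fun y => (A y).adjugate i j := by
  simp only [Matrix.adjugate_apply]
  refine contMDiff_det fun k l => ?_
  by_cases hk : k = j
  · subst hk
    simpa using contMDiff_const
  · simpa [Matrix.updateRow_ne hk] using hA k l

end Matrices

section Eval

variable {E : Type*} [NormedAddCommGroup E] [NormedSpace ℝ E]
  {M : Type*} [TopologicalSpace M] [ChartedSpace E M] [IsManifold 𝓘(ℝ, E) ∞ M]

theorem TwoForm.eval_swap (α : TwoForm E M) (Y Z : SmoothVectorField E M) (x : M) :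
    α.eval Y Z x = -α.eval Z Y x := by
  have h := α.alternating x (Y x + Z x)
  simp only [map_add, add_apply, α.alternating, TwoForm.eval] at h ⊢
  linarith

theorem TwoForm.eval_congr (α : TwoForm E M) {Y Y' Z Z' : SmoothVectorField E M} {x : M}
    (hY : Y x = Y' x) (hZ : Z x = Z' x) : α.eval Y Z x = α.eval Y' Z' x := by
  rw [TwoForm.eval, TwoForm.eval, hY, hZ]

end Eval

/-! ### Hamiltonian vector fields: existence, locality and abundance. -/

section Hamiltonian

variable {E : Type*} [NormedAddCommGroup E] [NormedSpace ℝ E] [FiniteDimensional ℝ E]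
  {M : Type*} [TopologicalSpace M] [ChartedSpace E M] [IsManifold 𝓘(ℝ, E) ∞ M]

/-- `X` is a Hamiltonian vector field of the function `f`. -/
def IsHamiltonian (Ω : SymplecticForm E M) (X : SmoothVectorField E M) (f : M → ℝ) : Prop :=
  ∀ (Y : SmoothVectorField E M) (x : M), Ω.eval X Y x = dirDeriv Y f x

theorem exists_toFun_eq (Ω : SymplecticForm E M) (x : M) (l : TangentSpace 𝓘(ℝ, E) x →L[ℝ] ℝ) :
    ∃ u : TangentSpace 𝓘(ℝ, E) x, Ω.toFun x u = l := by
  let B : E →L[ℝ] E →L[ℝ] ℝ := Ω.toFun x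
  let L : E →ₗ[ℝ] Module.Dual ℝ E := ContinuousLinearMap.coeLM ℝ ∘ₗ B.toLinearMap
  have hinj : Function.Injective L := by
    rw [← LinearMap.ker_eq_bot, LinearMap.ker_eq_bot']
    intro v hv
    exact Ω.nondegenerate x v fun w => LinearMap.congr_fun hv w
  have hsurj : Function.Surjective L :=
    (LinearMap.injective_iff_surjective_of_finrank_eq_finrank Subspace.dual_finrank_eq.symm).1 hinj
  obtain ⟨u, hu⟩ := hsurj (ContinuousLinearMap.coeLM ℝ (l : E →L[ℝ] ℝ))
  exact ⟨u, ContinuousLinearMap.ext fun w => LinearMap.congr_fun hu w⟩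

theorem eq_of_toFun_eq (Ω : SymplecticForm E M) {x : M} {u v : TangentSpace 𝓘(ℝ, E) x}
    (h : Ω.toFun x u = Ω.toFun x v) : u = v := by
  rw [← sub_eq_zero]
  refine Ω.nondegenerate x _ fun w => ?_
  rw [map_sub, h, sub_self]
  rfl

theorem isHamiltonian_zero (Ω : SymplecticForm E M) : IsHamiltonian Ω 0 0 := by
  intro Y x
  simp [TwoForm.eval, dirDeriv]

/-- Cartan's formula `L_X Ω = i_X dΩ + d i_X Ω`, with `dΩ = 0` and `i_X Ω = df`. The identity `ddf =
0` enters as `dirDeriv_bracket`. -/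
theorem IsHamiltonian.lieDeriv_eq_zero {Ω : SymplecticForm E M} {X : SmoothVectorField E M}
    {f : M → ℝ} (h : IsHamiltonian Ω X f) (hf : ContMDiff 𝓘(ℝ, E) 𝓘(ℝ, ℝ) ∞ f)
    (Y Z : SmoothVectorField E M) (x : M) : Ω.lieDeriv X Y Z x = 0 := by
  have h1 := Ω.closed X Y Z x
  have h2 := dirDeriv_bracket Y Z hf x
  have hY : Ω.eval X Y = dirDeriv Y f := funext (h Y)
  have hZ : Ω.eval X Z = dirDeriv Z f := funext (h Z)
  rw [← h, Ω.eval_swap] at h2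
  rw [TwoForm.extDeriv, hY, hZ, Ω.eval_swap ⁅X, Z⁆] at h1
  rw [TwoForm.lieDeriv]
  linarith

theorem IsHamiltonian.mem_conformallySymplectic {Ω : SymplecticForm E M}
    {X : SmoothVectorField E M} {f : M → ℝ} (h : IsHamiltonian Ω X f)
    (hf : ContMDiff 𝓘(ℝ, E) 𝓘(ℝ, ℝ) ∞ f) : X ∈ conformallySymplectic Ω :=
  ⟨0, fun Y Z x => by rw [h.lieDeriv_eq_zero hf, zero_mul]⟩

variable [T2Space M]

/-- Nondegeneracy gives the field pointwise. For smoothness, its coefficients in a local frame solve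
a linear system whose matrix is the Gram matrix of `Ω`, and Cramer's rule shows that they are
smooth. -/
theorem exists_isHamiltonian (Ω : SymplecticForm E M) {f : M → ℝ}
    (hf : ContMDiff 𝓘(ℝ, E) 𝓘(ℝ, ℝ) ∞ f) :
    ∃ X : SmoothVectorField E M, IsHamiltonian Ω X f := by
  choose X hX using fun x => exists_toFun_eq Ω x (mvfderiv 𝓘(ℝ, E) f x)
  suffices h : ContMDiff 𝓘(ℝ, E) (𝓘(ℝ, E).prod 𝓘(ℝ, E)) ∞
      (fun y => (Bundle.TotalSpace.mk' E y (X y) : TangentBundle 𝓘(ℝ, E) M)) from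
    ⟨⟨X, h⟩, fun Y x => congrArg (fun l => l (Y x)) (hX x)⟩
  intro x
  let n := Module.finrank ℝ E
  let b : Module.Basis (Fin n) ℝ E := Module.finBasis ℝ E
  choose e he using fun i => exists_field (E := E) x (b i)
  let G : M → Matrix (Fin n) (Fin n) ℝ := fun y => Matrix.of fun i j => Ω.eval (e i) (e j) y
  have hG (i j) : ContMDiff 𝓘(ℝ, E) 𝓘(ℝ, ℝ) ∞ fun y => G y i j := Ω.contMDiff_eval (e i) (e j)
  have hvec (a : Fin n → ℝ) (y : M) (j : Fin n) :
      Matrix.vecMul a (G y) j = Ω.toFun y (∑ i, a i • e i y) (e j y) := by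
    simp [Matrix.vecMul, dotProduct, G, TwoForm.eval]
  -- A left kernel vector of the Gram matrix would be a tangent vector in the radical of `Ω`.
  have hdet : (G x).det ≠ 0 := by
    intro h0
    obtain ⟨a, ha, h⟩ := Matrix.exists_vecMul_eq_zero_iff.2 h0
    have h1 : (∑ i, a i • e i x) = 0 := by
      refine Ω.nondegenerate x _ fun w => ?_
      obtain ⟨c, rfl⟩ : ∃ c : Fin n → ℝ, w = ∑ j, c j • e j x :=
        ⟨b.repr w, by simp only [he]; exact (b.sum_repr w).symm⟩
      rw [map_sum]
      refine Finset.sum_eq_zero fun j _ => ?_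
      rw [map_smul, ← hvec, h]
      simp
    simp only [he] at h1
    exact ha (funext fun i => Fintype.linearIndependent_iff.1 b.linearIndependent a h1 i)
  have hdetc := contMDiff_det hG
  let w : M → Fin n → ℝ := fun y j => dirDeriv (e j) f y
  have hw (j) : ContMDiff 𝓘(ℝ, E) 𝓘(ℝ, ℝ) ∞ fun y => w y j := contMDiff_dirDeriv (e j) hf
  let c : Fin n → M → ℝ := fun i y => (G y).det⁻¹ * ∑ j, w y j * (G y).adjugate j i
  have hc (i) : ContMDiffAt 𝓘(ℝ, E) 𝓘(ℝ, ℝ) ∞ (c i) x := by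
    refine ContMDiffAt.mul ?_ (contMDiff_finsetSum fun j _ =>
      (hw j).mul (contMDiff_adjugate hG j i)).contMDiffAt
    exact (contDiffAt_inv ℝ hdet).contMDiffAt.comp x (hdetc x)
  have hsm : ContMDiffAt 𝓘(ℝ, E) (𝓘(ℝ, E).prod 𝓘(ℝ, E)) ∞
      (fun y => (Bundle.TotalSpace.mk' E y (∑ i, c i y • e i y) : TangentBundle 𝓘(ℝ, E) M)) x :=
    ContMDiffAt.sum_section (t := fun i y => c i y • e i y)
      fun i _ => (hc i).smul_section ((e i).contMDiff x)
  refine hsm.congr_of_eventuallyEq ?_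
  have hev : ∀ᶠ y in nhds x, (G y).det ≠ 0 := hdetc.continuous.continuousAt.eventually_ne hdet
  filter_upwards [hev] with y hy
  let e' : Fin n → E := fun i => e i y
  -- The `e i` were prescribed only at `x`. Nearby, a linear relation would give a left kernel
  -- vector of the still invertible Gram matrix.
  have hli : LinearIndependent ℝ e' := by
    rw [Fintype.linearIndependent_iff]
    intro a ha
    have h2 : Matrix.vecMul a (G y) = 0 := by
      funext j
      rw [hvec]
      have : (∑ i, a i • e i y) = 0 := ha
      rw [this, map_zero]
      rfl
    exact congrFun (Matrix.eq_zero_of_vecMul_eq_zero hy h2)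
  let b' := basisOfLinearIndependentOfCardEqFinrank' _ hli (by simp [n])
  obtain ⟨a, ha⟩ : ∃ a : Fin n → ℝ, X y = ∑ i, a i • e i y :=
    ⟨b'.repr (X y), by
      have := (b'.sum_repr (X y)).symm
      simpa [b'] using! this⟩
  have hwa : w y = Matrix.vecMul a (G y) := by
    funext j
    rw [hvec, ← ha, hX]
    rfl
  have hca (i) : c i y = a i := by
    have h3 : Matrix.vecMul (w y) (G y).adjugate = (G y).det • a := by
      rw [hwa, Matrix.vecMul_vecMul, Matrix.mul_adjugate, Matrix.vecMul_smul, Matrix.vecMul_one]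
    have h4 := congrFun h3 i
    simp only [Matrix.vecMul, dotProduct, Pi.smul_apply, smul_eq_mul] at h4
    simp only [c]
    rw [h4, inv_mul_cancel_left₀ hy]
  simp only [hca, ha]

theorem IsHamiltonian.congr {Ω : SymplecticForm E M} {X X' : SmoothVectorField E M}
    {f f' : M → ℝ} (h : IsHamiltonian Ω X f) (h' : IsHamiltonian Ω X' f') {x : M}
    (hff' : f =ᶠ[nhds x] f') : ⇑X =ᶠ[nhds x] ⇑X' := by
  filter_upwards [hff'.eventuallyEq_nhds] with y hy
  refine eq_of_toFun_eq Ω (ContinuousLinearMap.ext fun v => ?_)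
  obtain ⟨Y, rfl⟩ := exists_field y v
  exact (h Y y).trans ((dirDeriv_congr rfl hy).trans (h' Y y).symm)

theorem exists_isHamiltonian_apply_eq (Ω : SymplecticForm E M) (x : M)
    (u : TangentSpace 𝓘(ℝ, E) x) :
    ∃ (f : M → ℝ) (X : SmoothVectorField E M), ContMDiff 𝓘(ℝ, E) 𝓘(ℝ, ℝ) ∞ f ∧
      IsHamiltonian Ω X f ∧ X x = u := by
  obtain ⟨f, hf, hfu⟩ := exists_dirDeriv_eq x (Ω.toFun x u)
  obtain ⟨X, hX⟩ := exists_isHamiltonian Ω hf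
  refine ⟨f, X, hf, hX, eq_of_toFun_eq Ω (ContinuousLinearMap.ext fun v => ?_)⟩
  obtain ⟨Y, rfl⟩ := exists_field x v
  exact (hX Y x).trans (hfu Y)

end Hamiltonian

/-! ### The Lie derivative of a two-form. -/

section LieDeriv

variable {E : Type*} [NormedAddCommGroup E] [NormedSpace ℝ E] [FiniteDimensional ℝ E]
  {M : Type*} [TopologicalSpace M] [ChartedSpace E M] [IsManifold 𝓘(ℝ, E) ∞ M]

/-- The Lie derivative as a linear function of the vector field. -/
noncomputable def TwoForm.lieDerivₗ (α : TwoForm E M) (Y Z : SmoothVectorField E M) (x : M) :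
    SmoothVectorField E M →ₗ[ℝ] ℝ where
  toFun X := α.lieDeriv X Y Z x
  map_add' X X' := by
    simp only [TwoForm.lieDeriv, dirDeriv, TwoForm.eval, add_lie, ContMDiffSection.coe_add,
      Pi.add_apply, map_add, add_apply]
    ring
  map_smul' a X := by
    simp only [TwoForm.lieDeriv, dirDeriv, TwoForm.eval, smul_lie, ContMDiffSection.coe_smul,
      Pi.smul_apply, map_smul, smul_apply, smul_eq_mul, RingHom.id_apply]
    ring

theorem TwoForm.lieDerivₗ_apply (α : TwoForm E M) (X Y Z : SmoothVectorField E M) (x : M) :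
    α.lieDerivₗ Y Z x X = α.lieDeriv X Y Z x := rfl

theorem TwoForm.lieDeriv_congr (α : TwoForm E M) {X X' : SmoothVectorField E M} {x : M}
    (h : ⇑X =ᶠ[nhds x] ⇑X') (Y Z : SmoothVectorField E M) :
    α.lieDeriv X Y Z x = α.lieDeriv X' Y Z x := by
  have h1 := (bracket_congr h (Filter.EventuallyEq.refl _ ⇑Y)).self_of_nhds
  have h2 := (bracket_congr h (Filter.EventuallyEq.refl _ ⇑Z)).self_of_nhds
  rw [TwoForm.lieDeriv, TwoForm.lieDeriv, dirDeriv_congr h.self_of_nhds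
    (Filter.EventuallyEq.refl _ _), α.eval_congr h1 rfl, α.eval_congr rfl h2]

theorem TwoForm.contMDiff_lieDeriv (α : TwoForm E M) (X Y Z : SmoothVectorField E M) :
    ContMDiff 𝓘(ℝ, E) 𝓘(ℝ, ℝ) ∞ (α.lieDeriv X Y Z) :=
  ((contMDiff_dirDeriv X (α.contMDiff_eval Y Z)).sub (α.contMDiff_eval _ _)).sub
    (α.contMDiff_eval _ _)

theorem TwoForm.lieDeriv_swap (α : TwoForm E M) (X Y Z : SmoothVectorField E M) (x : M) :
    α.lieDeriv X Y Z x = -α.lieDeriv X Z Y x := by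
  have h : α.eval Y Z = -α.eval Z Y := funext (α.eval_swap Y Z)
  rw [TwoForm.lieDeriv, TwoForm.lieDeriv, h, α.eval_swap ⁅X, Y⁆, α.eval_swap Y]
  simp only [dirDeriv, mvfderiv_neg, neg_apply]
  ring

/-- In the Leibniz expansion the terms with `X f` from the derivative and from the bracket cancel.
Sections merely differentiable at `x` are allowed so that the general criterion for pointwise
dependence applies. -/
theorem TwoForm.tensorialAt (α : TwoForm E M) (X Z : SmoothVectorField E M) (x : M) :
    TensorialAt 𝓘(ℝ, E) E (fun σ : (y : M) → TangentSpace 𝓘(ℝ, E) y =>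
      mvfderiv 𝓘(ℝ, E) (fun y => α.toFun y (σ y) (Z y)) x (X x)
        - α.toFun x (mlieBracket 𝓘(ℝ, E) X σ x) (Z x) - α.toFun x (σ x) (⁅X, Z⁆ x)) x := by
  have : CompleteSpace E := FiniteDimensional.complete ℝ E
  have := isManifold_two (E := E) (M := M)
  have hd {σ : (y : M) → TangentSpace 𝓘(ℝ, E) y}
      (hσ : MDifferentiableAt 𝓘(ℝ, E) (𝓘(ℝ, E).prod 𝓘(ℝ, E))
        (fun y => (Bundle.TotalSpace.mk' E y (σ y) : TangentBundle 𝓘(ℝ, E) M)) x) :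
      MDifferentiableAt 𝓘(ℝ, E) 𝓘(ℝ, ℝ) (fun y => α.toFun y (σ y) (Z y)) x := by
    have h := MDifferentiableAt.clm_bundle_apply₂ (E₁ := fun x : M => TangentSpace 𝓘(ℝ, E) x)
      (E₂ := fun x : M => TangentSpace 𝓘(ℝ, E) x) (E₃ := Bundle.Trivial M ℝ) (F₁ := E) (F₂ := E)
      (F₃ := ℝ) (b := id) (ψ := α.toFun) (v := σ) (w := Z)
      ((α.smooth x).mdifferentiableAt (by simp)) hσ (Z.mdifferentiableAt x)
    simp only [mdifferentiableAt_totalSpace] at h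
    simpa using! h.2
  constructor
  · intro f σ hf hσ
    have h1 : (fun y => α.toFun y ((f • σ) y) (Z y)) = f * fun y => α.toFun y (σ y) (Z y) := by
      funext y
      simp
    rw [h1, mvfderiv_mul hf (hd hσ), mlieBracket_smul_right hf hσ]
    simp only [add_apply, smul_apply, smul_eq_mul, map_add, map_smul, Pi.smul_apply']
    ring
  · intro σ σ' hσ hσ'
    have h1 : (fun y => α.toFun y ((σ + σ') y) (Z y)) =
        (fun y => α.toFun y (σ y) (Z y)) + fun y => α.toFun y (σ' y) (Z y) := by
      funext y
      simp
    rw [h1, mvfderiv_add (hd hσ) (hd hσ'), mlieBracket_add_right hσ hσ']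
    simp only [add_apply, map_add, Pi.add_apply]
    ring

theorem TwoForm.lieDeriv_congr_left (α : TwoForm E M) (X Z : SmoothVectorField E M)
    {Y Y' : SmoothVectorField E M} {x : M} (h : Y x = Y' x) :
    α.lieDeriv X Y Z x = α.lieDeriv X Y' Z x :=
  (α.tensorialAt X Z x).pointwise (Y.mdifferentiableAt x) (Y'.mdifferentiableAt x) h

theorem TwoForm.lieDeriv_add_left (α : TwoForm E M) (X Y Y' Z : SmoothVectorField E M) (x : M) :
    α.lieDeriv X (Y + Y') Z x = α.lieDeriv X Y Z x + α.lieDeriv X Y' Z x :=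
  (α.tensorialAt X Z x).add (Y.mdifferentiableAt x) (Y'.mdifferentiableAt x)

theorem TwoForm.lieDeriv_smul_left (α : TwoForm E M) (X Y Z : SmoothVectorField E M) (a : ℝ)
    (x : M) : α.lieDeriv X (a • Y) Z x = a * α.lieDeriv X Y Z x :=
  (α.tensorialAt X Z x).smul (f := fun _ => a) mdifferentiableAt_const (Y.mdifferentiableAt x)

/-- This is `L_[X,V] α = L_X L_V α - L_V L_X α` with the last term zero. The right-hand side spells
out `L_X` of the form `L_V α`. -/
theorem TwoForm.lieDeriv_bracket (α : TwoForm E M) (X V Y Z : SmoothVectorField E M)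
    (hX : ∀ (Y Z : SmoothVectorField E M) (x : M), α.lieDeriv X Y Z x = 0) (x : M) :
    α.lieDeriv ⁅X, V⁆ Y Z x = dirDeriv X (α.lieDeriv V Y Z) x - α.lieDeriv V ⁅X, Y⁆ Z x
      - α.lieDeriv V Y ⁅X, Z⁆ x := by
  have key (A B : SmoothVectorField E M) :
      dirDeriv X (α.eval A B) = α.eval ⁅X, A⁆ B + α.eval A ⁅X, B⁆ := by
    funext y
    have := hX A B y
    simp only [TwoForm.lieDeriv] at this
    simp only [Pi.add_apply]
    linarith
  have e1 := dirDeriv_bracket X V (α.contMDiff_eval Y Z) x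
  have e2 : α.lieDeriv V Y Z = dirDeriv V (α.eval Y Z) - α.eval ⁅V, Y⁆ Z - α.eval Y ⁅V, Z⁆ := rfl
  rw [key, dirDeriv_add V (α.contMDiff_eval _ _) (α.contMDiff_eval _ _)] at e1
  rw [e2, dirDeriv_sub X (f := dirDeriv V (α.eval Y Z) - α.eval ⁅V, Y⁆ Z)
      ((contMDiff_dirDeriv V (α.contMDiff_eval Y Z)).sub (α.contMDiff_eval _ _))
      (α.contMDiff_eval _ _),
    dirDeriv_sub X (contMDiff_dirDeriv V (α.contMDiff_eval Y Z)) (α.contMDiff_eval _ _), key, key]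
  simp only [TwoForm.lieDeriv, e1, lie_lie, Pi.add_apply]
  simp only [TwoForm.eval, ContMDiffSection.coe_sub, Pi.sub_apply, map_sub, sub_apply]
  ring

end LieDeriv

/-- The form `d = a(p,q) b - b(p,q) a` still satisfies the proportionality, and `d(p,q) = 0`. If
`a(u,v) ≠ 0` and `d(u,v) = 0`, then `d(u,·) = 0`. This propagates from `(p,q)` to `p`, to `q`, and
to every `u` with `a(u,p) ≠ 0`; any other `u` is reached through `u + q`. -/
theorem eq_mul_of_proportional {V : Type*} [AddCommGroup V] {a b : V → V → ℝ}
    (ha : ∀ u u' v, a (u + u') v = a u v + a u' v) (hb : ∀ u u' v, b (u + u') v = b u v + b u' v)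
    (ha' : ∀ u v, a u v = -a v u) (hb' : ∀ u v, b u v = -b v u)
    (h : ∀ u y z, a u y * b u z = a u z * b u y) {p q : V} (hpq : a p q ≠ 0) (y z : V) :
    b y z = b p q / a p q * a y z := by
  let d : V → V → ℝ := fun u v => a p q * b u v - b p q * a u v
  have hd (u y z : V) : a u y * d u z = a u z * d u y := by
    simp only [d]
    linear_combination a p q * h u y z
  have hdd (u v : V) : d u v = -d v u := by
    simp only [d, ha' u v, hb' u v]
    ring
  have hdpq : d p q = 0 := by
    simp only [d]
    ring
  have hvan {u v : V} (h1 : a u v ≠ 0) (h2 : d u v = 0) (z : V) : d u z = 0 := by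
    have := hd u v z
    rw [h2, mul_zero] at this
    exact (mul_eq_zero.1 this).resolve_left h1
  have hp (z : V) : d p z = 0 := hvan hpq hdpq z
  have hq (z : V) : d q z = 0 :=
    hvan (v := p) (by rw [ha']; simpa using hpq) (by rw [hdd, hp, neg_zero]) z
  have hgen {u : V} (hu : a u p ≠ 0) (z : V) : d u z = 0 :=
    hvan hu (by rw [hdd, hp, neg_zero]) z
  have hall (u z : V) : d u z = 0 := by
    by_cases hu : a u p = 0
    · have h1 : a (u + q) p ≠ 0 := by
        rw [ha, hu, zero_add, ha']
        simpa using hpq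
      have h2 := hgen h1 z
      have h3 := hq z
      simp only [d, ha, hb] at h2 h3 ⊢
      linarith
    · exact hgen hu z
  have := hall y z
  simp only [d] at this
  field_simp
  linarith

/-! ### The rank argument and the conformal factor. -/

section Main

variable {E : Type*} [NormedAddCommGroup E] [NormedSpace ℝ E] [FiniteDimensional ℝ E]
  {M : Type*} [TopologicalSpace M] [ChartedSpace E M] [IsManifold 𝓘(ℝ, E) ∞ M] [T2Space M]

theorem SymplecticForm.exists_eval_ne_zero [Nontrivial E] (Ω : SymplecticForm E M) (x : M) :
    ∃ Y Z : SmoothVectorField E M, Ω.eval Y Z x ≠ 0 := by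
  obtain ⟨v, hv⟩ := exists_ne (0 : E)
  by_contra! h
  refine hv (Ω.nondegenerate x v fun w => ?_)
  obtain ⟨Y, hY⟩ := exists_field (E := E) x v
  obtain ⟨Z, rfl⟩ := exists_field x w
  have := h Y Z
  rwa [TwoForm.eval, hY] at this

/-- A smooth function can be cut off near a point of a finite set, away from the other points. -/
theorem exists_cutoff {f : M → ℝ} (hf : ContMDiff 𝓘(ℝ, E) 𝓘(ℝ, ℝ) ∞ f) {n : ℕ} {p : Fin n → M}
    (hp : Function.Injective p) (i : Fin n) :
    ∃ g : M → ℝ, ContMDiff 𝓘(ℝ, E) 𝓘(ℝ, ℝ) ∞ g ∧ g =ᶠ[nhds (p i)] f ∧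
      ∀ j, j ≠ i → g =ᶠ[nhds (p j)] 0 := by
  have hfin : (p '' {i}ᶜ).Finite := Set.toFinite _
  have hmem : (p '' {i}ᶜ)ᶜ ∈ nhds (p i) := by
    refine hfin.isClosed.isOpen_compl.mem_nhds ?_
    rintro ⟨j, hj, hji⟩
    exact hj (hp hji)
  obtain ⟨χ, -, hχ⟩ :=
    (SmoothBumpFunction.nhds_basis_tsupport (I := 𝓘(ℝ, E)) (p i)).mem_iff.1 hmem
  refine ⟨χ * f, χ.contMDiff.mul hf, ?_, fun j hj => ?_⟩
  · filter_upwards [χ.eventuallyEq_one] with y hy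
    simp [hy]
  · have hpj : p j ∉ tsupport χ := fun h => hχ h ⟨j, hj, rfl⟩
    filter_upwards [(isClosed_tsupport χ).isOpen_compl.mem_nhds hpj] with y hy
    simp [image_eq_zero_of_notMem_tsupport hy]

/-- A local operator of finite rank modulo `ℝ Ω` vanishes. -/
theorem lieDeriv_bracket_eq_zero [Nontrivial E] {Ω : SymplecticForm E M}
    {𝔤 : LieSubalgebra ℝ (SmoothVectorField E M)} (hle : conformallySymplectic Ω ≤ 𝔤)
    [FiniteDimensional ℝ (𝔤.toSubmodule ⧸
      (conformallySymplectic Ω).toSubmodule.submoduleOf 𝔤.toSubmodule)]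
    {V X : SmoothVectorField E M} (hV : V ∈ 𝔤) {f : M → ℝ}
    (hf : ContMDiff 𝓘(ℝ, E) 𝓘(ℝ, ℝ) ∞ f) (hX : IsHamiltonian Ω X f)
    (Y Z : SmoothVectorField E M) (x : M) : Ω.lieDeriv ⁅X, V⁆ Y Z x = 0 := by
  by_contra hx
  let U : Set M := {y | Ω.lieDeriv ⁅X, V⁆ Y Z y ≠ 0}
  have hU : IsOpen U :=
    isOpen_ne_fun (Ω.contMDiff_lieDeriv ⁅X, V⁆ Y Z).continuous continuous_const
  have hinf : U.Infinite := infinite_of_isOpen (E := E) hU ⟨x, hx⟩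
  let d := Module.finrank ℝ (𝔤.toSubmodule ⧸
    (conformallySymplectic Ω).toSubmodule.submoduleOf 𝔤.toSubmodule)
  -- The first `d + 1` points give one vector too many for a quotient of dimension `d`. The last is
  -- a spare point, used to eliminate the multiple of `Ω`.
  let p : Fin (d + 2) → M := fun i => hinf.natEmbedding U i
  have hpU (i) : p i ∈ U := (hinf.natEmbedding U i).2
  have hp : Function.Injective p := fun i j hij =>
    Fin.ext ((hinf.natEmbedding U).injective (Subtype.ext hij))
  choose g hg hgi hgj using exists_cutoff hf hp
  choose W hW using fun i => exists_isHamiltonian Ω (hg i)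
  have hWi (i) : ⇑⁅W i, V⁆ =ᶠ[nhds (p i)] ⇑⁅X, V⁆ :=
    bracket_congr ((hW i).congr hX (hgi i)) (Filter.EventuallyEq.refl _ _)
  have hWj (i j) (hij : j ≠ i) : ⇑⁅W i, V⁆ =ᶠ[nhds (p j)] ⇑(0 : SmoothVectorField E M) := by
    rw [← zero_lie (L := SmoothVectorField E M) V]
    exact bracket_congr ((hW i).congr (isHamiltonian_zero Ω) (hgj i j hij))
      (Filter.EventuallyEq.refl _ _)
  have hWg (i) : ⁅W i, V⁆ ∈ 𝔤 :=
    𝔤.lie_mem (hle ((hW i).mem_conformallySymplectic (hg i))) hV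
  let q : Fin (d + 1) → 𝔤.toSubmodule ⧸
      (conformallySymplectic Ω).toSubmodule.submoduleOf 𝔤.toSubmodule :=
    fun i => Submodule.Quotient.mk ⟨⁅W i.castSucc, V⁆, hWg _⟩
  have hli : LinearIndependent ℝ q := by
    rw [Fintype.linearIndependent_iff]
    intro a ha
    have h1 : (∑ i, a i • ⁅W i.castSucc, V⁆) ∈ conformallySymplectic Ω := by
      have h2 : Submodule.Quotient.mk (p := (conformallySymplectic Ω).toSubmodule.submoduleOf
          𝔤.toSubmodule) (∑ i, a i • (⟨⁅W i.castSucc, V⁆, hWg _⟩ : 𝔤.toSubmodule)) = 0 := by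
        rw [← ha, ← Submodule.mkQ_apply, map_sum]
        rfl
      rw [Submodule.Quotient.mk_eq_zero, Submodule.submoduleOf, Submodule.mem_comap] at h2
      simpa using h2
    obtain ⟨c, hc⟩ := h1
    have hsum (Y Z : SmoothVectorField E M) (y : M) :
        ∑ i, a i * Ω.lieDeriv ⁅W i.castSucc, V⁆ Y Z y = c * Ω.eval Y Z y := by
      rw [← hc, ← TwoForm.lieDerivₗ_apply, map_sum]
      simp [TwoForm.lieDerivₗ_apply]
    have hzero (Y Z : SmoothVectorField E M) (i j) (hij : j ≠ i) :
        Ω.lieDeriv ⁅W i, V⁆ Y Z (p j) = 0 := by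
      rw [Ω.lieDeriv_congr (hWj i j hij), ← TwoForm.lieDerivₗ_apply, map_zero]
    -- All the brackets vanish near the spare point, while `Ω` does not vanish there.
    have hc0 : c = 0 := by
      obtain ⟨P, Q, hPQ⟩ := Ω.exists_eval_ne_zero (p (Fin.last _))
      have h3 := hsum P Q (p (Fin.last _))
      rw [Finset.sum_eq_zero fun i _ => by
        rw [hzero P Q _ _ (Fin.castSucc_lt_last i).ne', mul_zero]] at h3
      exact (mul_eq_zero.1 h3.symm).resolve_right hPQ
    intro j
    -- Near this point only the `j`-th bracket survives, and there it agrees with `[X, V]`, whose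
    -- Lie derivative is nonzero by the choice of `U`.
    have h3 := hsum Y Z (p j.castSucc)
    rw [hc0, zero_mul, Finset.sum_eq_single j
      (fun i _ hij => by
        rw [hzero Y Z _ _ (fun h => hij (Fin.castSucc_injective _ h).symm), mul_zero])
      (fun h => absurd (Finset.mem_univ j) h), Ω.lieDeriv_congr (hWi j.castSucc)] at h3
    exact (mul_eq_zero.1 h3).resolve_right (hpU j.castSucc)
  have := hli.fintype_card_le_finrank
  simp [d] at this

/-- Both sides are tensorial in `U`, so `U` may be replaced by a Hamiltonian field `X` of some `f`
with the same value at `x`. Comparing the invariance of `L_V Ω` under the fields of `f` and of `f²`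
leaves exactly the `df ∧ i_X` term. -/
theorem lieDeriv_proportional {Ω : SymplecticForm E M} {V : SmoothVectorField E M}
    (hV : ∀ (X : SmoothVectorField E M) (f : M → ℝ), ContMDiff 𝓘(ℝ, E) 𝓘(ℝ, ℝ) ∞ f →
      IsHamiltonian Ω X f → ∀ (Y Z : SmoothVectorField E M) (x : M), Ω.lieDeriv ⁅X, V⁆ Y Z x = 0)
    (U Y Z : SmoothVectorField E M) (x : M) :
    Ω.eval U Y x * Ω.lieDeriv V U Z x = Ω.eval U Z x * Ω.lieDeriv V U Y x := by
  obtain ⟨f, X, hf, hX, hXU⟩ := exists_isHamiltonian_apply_eq Ω x (U x)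
  rw [← Ω.eval_congr hXU rfl, ← Ω.eval_congr hXU rfl, ← Ω.lieDeriv_congr_left V Z hXU,
    ← Ω.lieDeriv_congr_left V Y hXU, hX, hX]
  have hff := hf.mul hf
  have hX2 : IsHamiltonian Ω ((2 : ℝ) • X.fsmul f hf) (f * f) := by
    intro A y
    rw [dirDeriv_mul A hf hf, ← hX]
    simp only [TwoForm.eval, ContMDiffSection.coe_smul, Pi.smul_apply,
      SmoothVectorField.fsmul_apply, map_smul, smul_apply, smul_eq_mul]
    ring
  have h1 := hV X f hf hX Y Z x
  have h2 := hV _ _ hff hX2 Y Z x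
  rw [Ω.lieDeriv_bracket _ _ _ _ (hX.lieDeriv_eq_zero hf)] at h1
  rw [Ω.lieDeriv_bracket _ _ _ _ (hX2.lieDeriv_eq_zero hff)] at h2
  have hbr (A : SmoothVectorField E M) : (⁅(2 : ℝ) • X.fsmul f hf, A⁆ : SmoothVectorField E M) x =
      ((-2 * dirDeriv A f x) • X + (2 * f x) • ⁅X, A⁆) x := by
    rw [smul_lie, ContMDiffSection.coe_smul, Pi.smul_apply, bracket_fsmul_left_apply]
    simp only [ContMDiffSection.coe_add, ContMDiffSection.coe_smul, Pi.add_apply, Pi.smul_apply]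
    module
  have hexp (A B : SmoothVectorField E M) :
      Ω.lieDeriv V ⁅(2 : ℝ) • X.fsmul f hf, A⁆ B x =
        -2 * dirDeriv A f x * Ω.lieDeriv V X B x + 2 * f x * Ω.lieDeriv V ⁅X, A⁆ B x := by
    rw [Ω.lieDeriv_congr_left V B (hbr A), Ω.lieDeriv_add_left, Ω.lieDeriv_smul_left,
      Ω.lieDeriv_smul_left]
  have hdir (g : M → ℝ) : dirDeriv ((2 : ℝ) • X.fsmul f hf) g x = 2 * f x * dirDeriv X g x := by
    simp only [dirDeriv, ContMDiffSection.coe_smul, Pi.smul_apply,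
      SmoothVectorField.fsmul_apply, map_smul, smul_eq_mul]
    ring
  rw [hdir, Ω.lieDeriv_swap V Y, hexp, hexp] at h2
  rw [Ω.lieDeriv_swap V Y] at h1
  -- The field of `f²` is `2fX`, so subtracting `f` times the identity for `X` cancels everything
  -- except the derivatives of `f`, which are values of `Ω(X, ·)`.
  linear_combination h2 / 2 - f x * h1

theorem mem_conformallySymplectic_of_lieDeriv_bracket [Nontrivial E] [PreconnectedSpace M]
    {Ω : SymplecticForm E M} {V : SmoothVectorField E M}
    (hV : ∀ (X : SmoothVectorField E M) (f : M → ℝ), ContMDiff 𝓘(ℝ, E) 𝓘(ℝ, ℝ) ∞ f →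
      IsHamiltonian Ω X f → ∀ (Y Z : SmoothVectorField E M) (x : M),
        Ω.lieDeriv ⁅X, V⁆ Y Z x = 0) :
    V ∈ conformallySymplectic Ω := by
  choose P Q hPQ using Ω.exists_eval_ne_zero
  let c : M → ℝ := fun x => Ω.lieDeriv V (P x) (Q x) x / Ω.eval (P x) (Q x) x
  have hc (Y Z : SmoothVectorField E M) (y : M) : Ω.lieDeriv V Y Z y = c y * Ω.eval Y Z y :=
    eq_mul_of_proportional (a := fun Y Z => Ω.eval Y Z y) (b := fun Y Z => Ω.lieDeriv V Y Z y)
      (fun _ _ _ => by simp [TwoForm.eval]) (fun _ _ _ => Ω.lieDeriv_add_left _ _ _ _ _)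
      (fun _ _ => Ω.eval_swap _ _ _) (fun _ _ => Ω.lieDeriv_swap _ _ _ _)
      (fun U Y Z => lieDeriv_proportional hV U Y Z y) (hPQ y) Y Z
  have hcs : ContMDiff 𝓘(ℝ, E) 𝓘(ℝ, ℝ) ∞ c := by
    intro x
    have h1 := (Ω.contMDiff_lieDeriv V (P x) (Q x) x).div₀ (Ω.contMDiff_eval (P x) (Q x) x) (hPQ x)
    -- The chosen pair varies with the point without any regularity, but the ratio does not depend
    -- on the pair. Near `x` it is computed with the pair fixed at `x`.
    refine h1.congr_of_eventuallyEq ?_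
    filter_upwards [(Ω.contMDiff_eval (P x) (Q x)).continuous.continuousAt.eventually_ne
      (hPQ x)] with y hy
    rw [Pi.div_apply, hc, mul_div_cancel_right₀ _ hy]
  have hdc (x : M) : mvfderiv 𝓘(ℝ, E) c x = 0 := by
    ext u
    obtain ⟨f, X, hf, hX, rfl⟩ := exists_isHamiltonian_apply_eq Ω x u
    have h1 := hV X f hf hX (P x) (Q x) x
    have h2 := hX.lieDeriv_eq_zero hf (P x) (Q x) x
    have h3 : Ω.lieDeriv V (P x) (Q x) = c * Ω.eval (P x) (Q x) := funext (hc _ _)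
    rw [Ω.lieDeriv_bracket _ _ _ _ (hX.lieDeriv_eq_zero hf), h3,
      dirDeriv_mul X hcs (Ω.contMDiff_eval _ _), hc, hc] at h1
    rw [TwoForm.lieDeriv] at h2
    -- This is `L_X (c Ω) = (X c) Ω + c L_X Ω`, where the left side and `L_X Ω` both vanish.
    have h4 : Ω.eval (P x) (Q x) x * dirDeriv X c x = 0 := by
      linear_combination h1 - c x * h2
    exact (mul_eq_zero.1 h4).resolve_left (hPQ x)
  have hloc := isLocallyConstant_of_mvfderiv_eq_zero hcs hdc
  rcases isEmpty_or_nonempty M with hM | ⟨⟨x₀⟩⟩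
  · exact ⟨0, fun _ _ x => (hM.false x).elim⟩
  · exact ⟨c x₀, fun Y Z x => by rw [hc, hloc.apply_eq_of_preconnectedSpace x x₀]⟩

end Main

end SymplecticManifold

theorem mainTheorem3
    {E : Type*} [NormedAddCommGroup E] [NormedSpace ℝ E] [FiniteDimensional ℝ E]
    {M : Type*} [TopologicalSpace M] [ChartedSpace E M] [IsManifold 𝓘(ℝ, E) ∞ M]
    [T2Space M] [PreconnectedSpace M]
    (Ω : SymplecticManifold.SymplecticForm E M) :
    ¬ ∃ 𝔤 : LieSubalgebra ℝ (SymplecticManifold.SmoothVectorField E M),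
        SymplecticManifold.conformallySymplectic Ω < 𝔤 ∧
        FiniteDimensional ℝ
          (𝔤.toSubmodule ⧸
            (SymplecticManifold.conformallySymplectic Ω).toSubmodule.submoduleOf
              𝔤.toSubmodule) := by
  rintro ⟨𝔤, hlt, hfin⟩
  refine hlt.not_ge fun V hV => ?_
  -- In dimension zero every vector field is zero, and the argument with many points is unavailable.
  rcases subsingleton_or_nontrivial E with hE | hE
  · have hV0 : V = 0 := ContMDiffSection.ext fun x => Subsingleton.elim (α := E) _ _
    rw [hV0]
    exact zero_mem _
  · exact SymplecticManifold.mem_conformallySymplectic_of_lieDeriv_bracket fun X f hf hX =>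
      SymplecticManifold.lieDeriv_bracket_eq_zero hlt.le hV hf hX
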